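/- Setting. Let $d\ge 1$ and let $K\subseteq\mathbb R^d$ be closed, convex and bounded and contain the closed unit $\ell_2$-ball. A sequence of agents $A=(a_1,\dots,a_n)$, $a_t=(x_t,y_t,d_t)$, is fixed in advance (oblivious adversary), with $x_t\in\mathbb R^d$, $y_t\in\{-1,1\}$ and a manipulation cost $d_t:\mathbb R^d\times\mathbb R^d\to\mathbb R$. Facing a classifier $\beta$, a non-strategic agent ($y_t=1$) reports $\hat x_t(\beta)=x_t$, and a strategic agent ($y_t=-1$) reports a best response $\hat x_t(\beta)\in\arg\max_{x}\,\langle\beta,x\rangle-d_t(x_t,x)$, ties broken arbitrarily. For strategic agents $d_t(x_t,x)=f_t(x-x_t)$, where $f_t:\mathbb R^d\to\mathbb R$ is convex, positive away from $0$ and positive homogeneous of some degree $r_t>1$. The loss in round $t$ is $c_t(\beta)=c(\hat x_t(\beta),y_t,\beta)=h(y_t\langle\hat x_t(\beta),\beta\rangle)$, with $h:\mathbb R\to\mathbb R$ convex and non-increasing (for instance the logistic loss $h(z)=\log(1+e^{-z})$ or the hinge loss $h(z)=\max(0,1-z)$). Assume that for every $t$, $|c_t|\le M$ on $K$ and $c_t$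 is $L$-Lipschitz on $K$ for the $\ell_2$ norm. Let $\theta=\#\{t:y_t=-1\}/n$. The Stackelberg regret of $B=(b_1,\dots,b_n)$ is $$\mathcal R_S(A,B)=\sum_{t=1}^n c_t(b_t)-\min_{\beta\in K}\sum_{t=1}^n c_t(\beta).$$ Algorithm 1. Fix $\delta\in(0,1]$, $\eta>0$, let $K_\delta=\{(1-\delta)\beta:\beta\in K\}$ and start at a point $\beta_1\in K_\delta$. In round $t$ draw $S_t$ uniformly from the unit sphere of $\mathbb R^d$, independently of the past, deploy $\beta_t^+=\beta_t+\delta S_t$ and suffer the loss $c_t(\beta_t^+)$. If $y_t=1$, let $g_t$ be any subgradient in $\partial c_t(\beta_t)$ (chosen measurably, from the information available through round $t$); if $y_t=-1$, let $g_t=\frac d\delta\,c_t(\beta_t^+)\,S_t$. Set $\beta_{t+1}=\Pi_{K_\delta}(\beta_t-\eta g_t)$, where $\Pi_{K_\delta}$ is the Euclidean projection onto $K_\delta$. Theorem. Let $R$ be such that $\|\beta\|_2\le R$ for all $\beta\in K$ and $\|\beta-\beta_1\|_2\le R$ for all $\beta\in K_\delta$ (for instance, $R$ is any bound on the norm over $K$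 if $\beta_1=0$, or the diameter of $K$ for an arbitrary $\beta_1\in K_\delta$). Then $$\mathbb E[\mathcal R_S(A,B)]\le\frac\eta2\Big[n\theta\,\frac{d^2M^2}{\delta^2}+n(1-\theta)L^2\Big]+\frac{R^2}{2\eta}+3nL\delta+nLR\delta,$$ both for the sequence of deployed classifiers $B=(\beta_1^+,\dots,\beta_n^+)$ and for the sequence of iterates $B=(\beta_1,\dots,\beta_n)$. -/

import Mathlib

open MeasureTheory ProbabilityTheory
open scoped NNReal

/-- The parameter and feature space `ℝ^d` with its Euclidean norm. -/
abbrev Vec (d : ℕ) : Type := EuclideanSpace ℝ (Fin d)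

/-- An agent `(x, y, d)`: true feature vector, true label, and the cost `cost x z` of changing
the feature vector `x` into `z`. -/
structure Agent (d : ℕ) where
  x : Vec d
  y : ℤ
  y_mem : y = 1 ∨ y = -1
  cost : Vec d → Vec d → ℝ

/-- The agent's utility from reporting `z` when the classifier is `β`. -/
noncomputable def Agent.utility {d : ℕ} (a : Agent d) (z β : Vec d) : ℝ :=
  inner ℝ β z - a.cost a.x z

/-- The reports the agent may send when facing `β`: any best response if she is strategic
(`y = -1`), and only her true feature vector if she is non-strategic (`y = 1`). -/
def Agent.responses {d : ℕ} (a : Agent d) (β : Vec d) : Set (Vec d) :=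
  {z | (a.y = -1 → ∀ w, a.utility w β ≤ a.utility z β) ∧ (a.y = 1 → z = a.x)}

/-- The manipulation costs under consideration: `cost x z = f (z - x)` with `f` convex, positive
away from the origin, and positive homogeneous of some degree `r > 1`. -/
def AdmissibleCost {d : ℕ} (cost : Vec d → Vec d → ℝ) : Prop :=
  ∃ (f : Vec d → ℝ) (r : ℝ), 1 < r ∧ (∀ v, v ≠ 0 → 0 < f v) ∧ ConvexOn ℝ Set.univ f ∧
    (∀ (α : ℝ) (v : Vec d), 0 < α → f (α • v) = α ^ r * f v) ∧
    ∀ x z, cost x z = f (z - x)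

/-- The classification loss `c(z, y, β) = h (y ⟪z, β⟫)` with margin function `h`
(`h z = log (1 + exp (-z))`: logistic loss; `h z = max 0 (1 - z)`: hinge loss). -/
noncomputable def classLoss {d : ℕ} (h : ℝ → ℝ) (z : Vec d) (y : ℤ) (β : Vec d) : ℝ :=
  h ((y : ℝ) * inner ℝ z β)

/-- The learner's loss `c_t(β) = c(x̂(β), y, β)` against agent `a` with response map `xhat`. -/
noncomputable def roundLoss {d : ℕ} (h : ℝ → ℝ) (a : Agent d) (xhat : Vec d → Vec d)
    (β : Vec d) : ℝ :=
  classLoss h (xhat β) a.y β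

/-- Stackelberg regret on `K` of the classifiers `B` against the agents `A`, who respond through
the maps `xhat`. For a nonempty compact `K` and continuous round losses the infimum is a minimum. -/
noncomputable def stackelbergRegret {d n : ℕ} (K : Set (Vec d)) (h : ℝ → ℝ)
    (A : Fin n → Agent d) (xhat : Fin n → Vec d → Vec d) (B : Fin n → Vec d) : ℝ :=
  (∑ t, roundLoss h (A t) (xhat t) (B t)) -
    sInf ((fun β => ∑ t, roundLoss h (A t) (xhat t) β) '' K)

/-- The fraction `θ` of strategic rounds. -/
noncomputable def strategicFraction {d n : ℕ} (A : Fin n → Agent d) : ℝ :=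
  ((Finset.univ.filter fun t => (A t).y = -1).card : ℝ) / n

/-- The subdifferential of `c` at `β`. -/
def subdifferential {d : ℕ} (c : Vec d → ℝ) (β : Vec d) : Set (Vec d) :=
  {g | ∀ β', c β + inner ℝ g (β' - β) ≤ c β'}

/-- The shrunken feasible set `K_δ = {(1 - δ) β | β ∈ K}`. -/
def shrink {d : ℕ} (K : Set (Vec d)) (δ : ℝ) : Set (Vec d) :=
  (fun β => (1 - δ) • β) '' K

/-- `p` is the Euclidean projection of `v` onto `C`. -/
def IsEuclideanProj {d : ℕ} (C : Set (Vec d)) (v p : Vec d) : Prop :=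
  p ∈ C ∧ ∀ q ∈ C, ‖v - p‖ ≤ ‖v - q‖

/-- The uniform distribution on the unit sphere of `ℝ^d`: normalized surface measure. -/
noncomputable def uniformSphere (d : ℕ) : Measure (Metric.sphere (0 : Vec d) 1) :=
  ((volume : Measure (Vec d)).toSphere Set.univ)⁻¹ • (volume : Measure (Vec d)).toSphere

/-- The classifier `β_t + δ S_t` that is deployed in a round. -/
noncomputable def deployed {d : ℕ} (δ : ℝ) (β : Vec d) (s : Metric.sphere (0 : Vec d) 1) : Vec d :=
  β + δ • (s : Vec d)

/-- `(S, g, β)` is a run of the mixture-feedback algorithm on the agents `A` (fixed in advance),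
with smoothing parameter `δ`, step size `η` and starting point `b₁`. `β t.castSucc` is the iterate
at the beginning of round `t`, `β t.succ` the one after it, `ℱ t.castSucc` is the information
available before round `t`. Each direction `S t` is uniform on the sphere and independent of that
information. In a non-strategic round `g t` is an arbitrary subgradient, whose choice may use
everything up to and including that round. -/
structure IsMixtureRun {d n : ℕ} (K : Set (Vec d)) (h : ℝ → ℝ) (A : Fin n → Agent d)
    (xhat : Fin n → Vec d → Vec d) (δ η : ℝ) (b₁ : Vec d)
    {Ω : Type*} [mΩ : MeasurableSpace Ω] (P : Measure Ω) (ℱ : Filtration (Fin (n + 1)) mΩ)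
    (S : Fin n → Ω → Metric.sphere (0 : Vec d) 1) (g : Fin n → Ω → Vec d)
    (β : Fin (n + 1) → Ω → Vec d) : Prop where
  init : ∀ ω, β 0 ω = b₁
  measurable_direction : ∀ t, Measurable[ℱ t.succ] (S t)
  direction_law : ∀ t, P.map (S t) = uniformSphere d
  direction_fresh : ∀ t, Indep (MeasurableSpace.comap (S t) inferInstance) (ℱ t.castSucc) P
  measurable_gradient : ∀ t, Measurable[ℱ t.succ] (g t)
  gradient_nonstrategic : ∀ t, (A t).y = 1 → ∀ ω,
    g t ω ∈ subdifferential (roundLoss h (A t) (xhat t)) (β t.castSucc ω)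
  gradient_strategic : ∀ t, (A t).y = -1 → ∀ ω,
    g t ω = ((d : ℝ) / δ * roundLoss h (A t) (xhat t) (deployed δ (β t.castSucc ω) (S t ω))) •
      (S t ω : Vec d)
  update : ∀ t ω, IsEuclideanProj (shrink K δ) (β t.castSucc ω - η • g t ω) (β t.succ ω)

/-- The regret bound
`(η/2) (n θ d² M² / δ² + n (1 - θ) L²) + R² / (2η) + 3 n L δ + n L R δ`. -/
noncomputable def regretBound (n d : ℕ) (θ η δ M L R : ℝ) : ℝ :=
  η / 2 * (n * θ * ((d : ℝ) ^ 2 * M ^ 2 / δ ^ 2) + n * (1 - θ) * L ^ 2) +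
    1 / (2 * η) * R ^ 2 + 3 * n * L * δ + n * L * R * δ

/-!
The round losses are convex on all of `ℝ^d`. For a strategic agent, write the best response as
`x + v`; homogeneity of degree `r` gives Euler's identity `⟪β, v⟫ = r f(v)`, so
`⟪x̂(β), β⟫ = ⟪x, β⟫ + r / (r - 1) · sup_w (⟪β, w⟫ - f w)` is convex in `β`, and a convex
non-increasing `h` applied to the negative of a convex function is convex
(`convexOn_roundLoss`).

In a strategic round the estimator `(d / δ) c(β + δ S) S` is, in expectation, a subgradient of `c`
at `β` up to an error `2 L δ` (`ConvexOn.sub_le_integral_uniformSphere`). This is usually derived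
from Stokes' theorem for the ball average of `c`. Here it comes from symmetry instead: put
`v = β - w` and pair each direction `s` with its mirror image `s'` in `vᗮ`. The points `β + δ s`
and `β + δ s'` differ by the multiple `2 δ ⟪s, v⟫ / ‖v‖²` of `v`, so monotonicity of the difference
quotients of `c` along `v` bounds `⟪s, v⟫ (c(β + δ s) - c(β + δ s'))` below by
`2 δ ⟪s, v⟫² / ‖v‖² · (c(β) - c(w) - 2 L δ)`; averaging over the sphere with
`∫ ⟪s, v⟫² = ‖v‖² / d` gives the claim.

The rest is projected online gradient descent. Since `S t` is independent of the iterate `β t`,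
the joint law is a product and the deterministic estimate can be integrated
(`IsMixtureRun.integral_sub_le_of_strategic`). The telescoping bound on
`∑ ⟪g t, β t - w⟫` uses `‖g t‖ ≤ d M / δ` in strategic rounds and `‖g t‖ ≤ L` in the others.
Finally, replacing the comparator `u ∈ K` by `(1 - δ) u ∈ K_δ` costs `L R δ` per round, and
replacing the iterate by the deployed classifier costs `L δ` per round.
-/

/-! ### Convexity of the round losses -/

lemma ConvexOn.comp_const_mul_inner {d : ℕ} {h : ℝ → ℝ} (hh : ConvexOn ℝ Set.univ h)
    (k : ℝ) (x : Vec d) : ConvexOn ℝ Set.univ fun β : Vec d => h (k * inner ℝ x β) := by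
  have := hh.comp_linearMap (k • (innerSL ℝ x : Vec d →L[ℝ] ℝ)).toLinearMap
  simpa [Function.comp_def] using this

/-- Euler's identity for a best response: if `v` maximizes `⟪β, ·⟫ - f` and `f` is positive
homogeneous of degree `r`, then `⟪β, v⟫ = r f v`. -/
lemma inner_eq_degree_mul_of_isMax {d : ℕ} {f : Vec d → ℝ} {r : ℝ}
    (hf : ∀ (α : ℝ) (v : Vec d), 0 < α → f (α • v) = α ^ r * f v) {β v : Vec d}
    (hv : ∀ w, inner ℝ β w - f w ≤ inner ℝ β v - f v) : inner ℝ β v = r * f v := by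
  -- Compare `v` with its positive multiples: `α = 1` maximizes the utility along the ray.
  have hmax : IsLocalMax (fun α : ℝ => α * inner ℝ β v - α ^ r * f v) 1 := by
    filter_upwards [lt_mem_nhds (one_pos : (0 : ℝ) < 1)] with α hα
    simpa [hf α v hα, inner_smul_right] using hv (α • v)
  have hd : HasDerivAt (fun α : ℝ => α * inner ℝ β v - α ^ r * f v)
      (1 * inner ℝ β v - r * 1 ^ (r - 1) * f v) 1 :=
    ((hasDerivAt_id' (1 : ℝ)).mul_const _).sub
      ((Real.hasDerivAt_rpow_const (Or.inl one_ne_zero)).mul_const _)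
  have := hmax.hasDerivAt_eq_zero hd
  simp only [one_mul, Real.one_rpow, mul_one] at this
  linarith

/-- The margin `⟪x̂(β), β⟫` of a strategic agent is convex: it is affine plus `r / (r - 1)` times
the optimal utility, a supremum of affine functions of `β`. -/
lemma convexOn_inner_response {d : ℕ} {a : Agent d} (ha : AdmissibleCost a.cost)
    (hy : a.y = -1) {xhat : Vec d → Vec d} (hx : ∀ β, xhat β ∈ a.responses β) :
    ConvexOn ℝ Set.univ fun β => inner ℝ (xhat β) β := by
  obtain ⟨f, r, hr, -, -, hf, hcost⟩ := ha
  have hmax : ∀ β w, inner ℝ β w - f w ≤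
      inner ℝ β (xhat β - a.x) - f (xhat β - a.x) := by
    intro β w
    have := (hx β).1 hy (a.x + w)
    simp only [Agent.utility, hcost, add_sub_cancel_left, inner_add_right] at this
    rw [inner_sub_right]
    linarith
  have hval : ∀ β, inner ℝ (xhat β) β = inner ℝ a.x β +
      r / (r - 1) * (inner ℝ β (xhat β - a.x) - f (xhat β - a.x)) := by
    intro β
    have h1 := inner_eq_degree_mul_of_isMax hf (hmax β)
    have h2 : inner ℝ (xhat β) β = inner ℝ a.x β + inner ℝ β (xhat β - a.x) := by
      rw [inner_sub_right, real_inner_comm β (xhat β), real_inner_comm β a.x]; ring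
    have h3 : r - 1 ≠ 0 := by linarith
    rw [h2, h1]
    field_simp
  have hconv : ConvexOn ℝ Set.univ fun β =>
      inner ℝ β (xhat β - a.x) - f (xhat β - a.x) := by
    refine ⟨convex_univ, fun β₁ _ β₂ _ s t hs ht hst => ?_⟩
    set v := xhat (s • β₁ + t • β₂) - a.x
    have e : inner ℝ (s • β₁ + t • β₂) v - f v =
        s * (inner ℝ β₁ v - f v) + t * (inner ℝ β₂ v - f v) := by
      rw [inner_add_left, real_inner_smul_left, real_inner_smul_left]
      linear_combination f v * hst
    simp only [smul_eq_mul]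
    rw [e]
    exact add_le_add (mul_le_mul_of_nonneg_left (hmax β₁ v) hs)
      (mul_le_mul_of_nonneg_left (hmax β₂ v) ht)
  have hlin : ConvexOn ℝ Set.univ fun β : Vec d => inner ℝ a.x β :=
    (innerSL ℝ a.x : Vec d →L[ℝ] ℝ).toLinearMap.convexOn convex_univ
  have := hlin.add (hconv.smul (c := r / (r - 1)) (by apply div_nonneg <;> linarith))
  refine this.congr fun β _ => ?_
  simp [hval β]

lemma convexOn_roundLoss {d : ℕ} {h : ℝ → ℝ} (hanti : Antitone h)
    (hconvex : ConvexOn ℝ Set.univ h) {a : Agent d} (ha : a.y = -1 → AdmissibleCost a.cost)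
    {xhat : Vec d → Vec d} (hx : ∀ β, xhat β ∈ a.responses β) :
    ConvexOn ℝ Set.univ (roundLoss h a xhat) := by
  rcases a.y_mem with hy | hy
  · refine (ConvexOn.comp_const_mul_inner hconvex 1 a.x).congr fun β _ => ?_
    simp [roundLoss, classLoss, hy, (hx β).2 hy]
  · have hm := convexOn_inner_response (ha hy) hy hx
    refine ⟨convex_univ, fun β₁ _ β₂ _ s t hs ht hst => ?_⟩
    have h1 := hm.2 (Set.mem_univ β₁) (Set.mem_univ β₂) hs ht hst
    have h2 := hconvex.2 (Set.mem_univ (-inner ℝ (xhat β₁) β₁))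
      (Set.mem_univ (-inner ℝ (xhat β₂) β₂)) hs ht hst
    simp only [roundLoss, classLoss, hy, smul_eq_mul] at h1 h2 ⊢
    push_cast
    simp only [neg_mul, one_mul]
    refine (hanti ?_).trans h2
    linarith

/-! ### The uniform distribution on the sphere -/

/-- The action of a linear isometry on the unit sphere. -/
noncomputable def sphereMap {d : ℕ} (U : Vec d ≃ₗᵢ[ℝ] Vec d) (s : Metric.sphere (0 : Vec d) 1) :
    Metric.sphere (0 : Vec d) 1 :=
  ⟨U s, by simp⟩

lemma measurable_sphereMap {d : ℕ} (U : Vec d ≃ₗᵢ[ℝ] Vec d) : Measurable (sphereMap U) :=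
  (U.continuous.measurable.comp measurable_subtype_coe).subtype_mk

open scoped Pointwise in
lemma map_sphereMap_uniformSphere {d : ℕ} (U : Vec d ≃ₗᵢ[ℝ] Vec d) :
    (uniformSphere d).map (sphereMap U) = uniformSphere d := by
  rw [uniformSphere, Measure.map_smul]
  congr 1
  ext s hs
  rw [Measure.map_apply (measurable_sphereMap U) hs, Measure.toSphere_apply' _ hs,
    Measure.toSphere_apply' _ (measurable_sphereMap U hs)]
  congr 1
  have : Set.Ioo (0 : ℝ) 1 • ((↑) '' (sphereMap U ⁻¹' s) : Set (Vec d)) =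
      U ⁻¹' (Set.Ioo (0 : ℝ) 1 • ((↑) '' s)) := by
    ext z
    simp only [Set.mem_smul, Set.mem_image, Set.mem_preimage]
    constructor
    · rintro ⟨r, hr, _, ⟨u, hu, rfl⟩, rfl⟩
      exact ⟨r, hr, _, ⟨_, hu, rfl⟩, by simp [sphereMap]⟩
    · rintro ⟨r, hr, _, ⟨u, hu, rfl⟩, hz⟩
      refine ⟨r, hr, _, ⟨sphereMap U.symm u, ?_, rfl⟩, ?_⟩
      · simpa [sphereMap] using hu
      · simp only [sphereMap]
        rw [← map_smul, hz, U.symm_apply_apply]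
  rw [this]
  exact U.measurePreserving.measure_preimage_equiv (f := U.toMeasurableEquiv) _

lemma integral_comp_sphereMap {d : ℕ} (U : Vec d ≃ₗᵢ[ℝ] Vec d)
    {F : Metric.sphere (0 : Vec d) 1 → ℝ} (hF : Continuous F) :
    ∫ s, F (sphereMap U s) ∂uniformSphere d = ∫ s, F s ∂uniformSphere d := by
  conv_rhs => rw [← map_sphereMap_uniformSphere U]
  rw [integral_map (measurable_sphereMap U).aemeasurable hF.aestronglyMeasurable]

instance isFiniteMeasure_uniformSphere {d : ℕ} : IsFiniteMeasure (uniformSphere d) := by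
  constructor
  rw [uniformSphere, Measure.smul_apply, smul_eq_mul]
  exact (ENNReal.inv_mul_le_one _).trans_lt ENNReal.one_lt_top

lemma isProbabilityMeasure_uniformSphere {d : ℕ} (hd : d ≠ 0) :
    IsProbabilityMeasure (uniformSphere d) := by
  constructor
  have : Nonempty (Fin d) := ⟨⟨0, Nat.pos_of_ne_zero hd⟩⟩
  rw [uniformSphere, Measure.smul_apply, smul_eq_mul]
  exact ENNReal.inv_mul_cancel (by simp [-Measure.toSphere_apply_univ]) (measure_ne_top _ _)

lemma integrable_uniformSphere {d : ℕ} {F : Metric.sphere (0 : Vec d) 1 → ℝ}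
    (hF : Continuous F) : Integrable F (uniformSphere d) :=
  hF.integrable_of_hasCompactSupport (HasCompactSupport.of_compactSpace F)

/-- The covariance of the uniform distribution on the sphere is `1 / d` times the identity. -/
lemma integral_inner_sq_uniformSphere {d : ℕ} (hd : d ≠ 0) (v : Vec d) :
    ∫ s, (inner ℝ (s : Vec d) v) ^ 2 ∂uniformSphere d = ‖v‖ ^ 2 / d := by
  have := isProbabilityMeasure_uniformSphere hd
  have hcont : ∀ w : Vec d, Continuous fun s : Metric.sphere (0 : Vec d) 1 =>
      (inner ℝ (s : Vec d) w) ^ 2 := fun w => by fun_prop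
  -- A reflection carries `v` to any vector of the same length, in particular to each `‖v‖ eᵢ`.
  have hsymm : ∀ w : Vec d, ‖w‖ = ‖v‖ → ∫ s, (inner ℝ (s : Vec d) w) ^ 2 ∂uniformSphere d =
      ∫ s, (inner ℝ (s : Vec d) v) ^ 2 ∂uniformSphere d := by
    intro w hw
    set U := (ℝ ∙ (v - w))ᗮ.reflection
    rw [← integral_comp_sphereMap U (hcont w)]
    congr 1 with s
    rw [← Submodule.reflection_sub hw.symm]
    exact congrArg (· ^ 2) (U.inner_map_map _ _)
  have hsum : ∑ i : Fin d, ∫ s, (inner ℝ (s : Vec d) (‖v‖ • EuclideanSpace.single i (1 : ℝ))) ^ 2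
      ∂uniformSphere d = ‖v‖ ^ 2 := by
    rw [← integral_finsetSum _ fun i _ => integrable_uniformSphere (hcont _)]
    have : ∀ s : Metric.sphere (0 : Vec d) 1, ∑ i : Fin d,
        (inner ℝ (s : Vec d) (‖v‖ • EuclideanSpace.single i (1 : ℝ))) ^ 2 = ‖v‖ ^ 2 := by
      intro s
      have hs : ‖(s : Vec d)‖ ^ 2 = 1 := by simp
      rw [EuclideanSpace.real_norm_sq_eq] at hs
      simp [inner_smul_right, mul_pow, ← Finset.mul_sum, EuclideanSpace.inner_single_right, hs]
    simp [this]
  rw [Finset.sum_congr rfl fun i _ => hsymm _ (by simp [norm_smul])] at hsum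
  rw [← hsum]
  have : (d : ℝ) ≠ 0 := by exact_mod_cast hd
  simp [this]

/-! ### The one-point gradient estimate -/

/-- Monotonicity of difference quotients of a convex function along the line through `x` with
direction `v`, without division. -/
lemma ConvexOn.mul_sub_le_sub {d : ℕ} {c : Vec d → ℝ} (hc : ConvexOn ℝ Set.univ c)
    (x v : Vec d) {k : ℝ} (hk : 0 ≤ k) : k * (c x - c (x - v)) ≤ c (x + k • v) - c x := by
  have hk' : (1 : ℝ) + k ≠ 0 := by positivity
  have h := hc.2 (Set.mem_univ (x + k • v)) (Set.mem_univ (x - v))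
    (show 0 ≤ 1 / (1 + k) by positivity) (show 0 ≤ k / (1 + k) by positivity) (by field_simp)
  have e : (1 / (1 + k)) • (x + k • v) + (k / (1 + k)) • (x - v) = x := by
    match_scalars <;> field_simp
    ring
  rw [e, smul_eq_mul, smul_eq_mul] at h
  have h2 := mul_le_mul_of_nonneg_left h (show 0 ≤ 1 + k by positivity)
  field_simp at h2
  linarith

/-- Comparing `c` at a point of the sphere around `b` with its mirror image in the hyperplane
orthogonal to `v`. Both sides are invariant under the reflection, which changes the sign of
`⟪s, v⟫`, so the case `0 ≤ ⟪s, v⟫` suffices. -/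
lemma ConvexOn.sq_inner_mul_le_reflection {d : ℕ} {c : Vec d → ℝ} (hc : ConvexOn ℝ Set.univ c)
    {δ D : ℝ} (hδ : 0 < δ) {b v : Vec d} (hv : v ≠ 0)
    (hD : ∀ s : Vec d, ‖s‖ = 1 → D ≤ c (b + δ • s) - c (b - v + δ • s)) {s : Vec d}
    (hs : ‖s‖ = 1) :
    2 * δ * D / ‖v‖ ^ 2 * inner ℝ s v ^ 2 ≤
      inner ℝ s v * (c (b + δ • s) - c (b + δ • (ℝ ∙ v)ᗮ.reflection s)) := by
  have hrefl : ∀ s : Vec d,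
      (ℝ ∙ v)ᗮ.reflection s = s - (2 * (inner ℝ s v / ‖v‖ ^ 2)) • v := by
    intro s
    rw [Submodule.reflection_orthogonal_apply, Submodule.reflection_singleton_apply,
      real_inner_comm]
    simp only [RCLike.ofReal_real_eq_id, id]
    module
  have hv2 : ‖v‖ ^ 2 ≠ 0 := by simpa using hv
  have key : ∀ s : Vec d, ‖s‖ = 1 → 0 ≤ inner ℝ s v →
      2 * δ * D / ‖v‖ ^ 2 * inner ℝ s v ^ 2 ≤
        inner ℝ s v * (c (b + δ • s) - c (b + δ • (ℝ ∙ v)ᗮ.reflection s)) := by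
    intro s hs h0
    have hk : 0 ≤ 2 * δ * inner ℝ s v / ‖v‖ ^ 2 := by positivity
    have h1 := hc.mul_sub_le_sub (b + δ • (ℝ ∙ v)ᗮ.reflection s) v hk
    have e1 : b + δ • (ℝ ∙ v)ᗮ.reflection s + (2 * δ * inner ℝ s v / ‖v‖ ^ 2) • v = b + δ • s := by
      rw [hrefl]; module
    have e2 : b + δ • (ℝ ∙ v)ᗮ.reflection s - v = b - v + δ • (ℝ ∙ v)ᗮ.reflection s := by abel
    rw [e1, e2] at h1
    have h2 := mul_le_mul_of_nonneg_left
      (hD ((ℝ ∙ v)ᗮ.reflection s) (by rw [LinearIsometryEquiv.norm_map, hs])) hk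
    calc _ = inner ℝ s v * (2 * δ * inner ℝ s v / ‖v‖ ^ 2 * D) := by ring
      _ ≤ _ := mul_le_mul_of_nonneg_left (h2.trans h1) h0
  rcases le_total 0 (inner ℝ s v) with h0 | h0
  · exact key s hs h0
  · have hin : inner ℝ ((ℝ ∙ v)ᗮ.reflection s) v = -inner ℝ s v := by
      rw [hrefl, inner_sub_left, real_inner_smul_left, real_inner_self_eq_norm_sq]
      field_simp
      ring
    have := key ((ℝ ∙ v)ᗮ.reflection s) (by rw [LinearIsometryEquiv.norm_map, hs])
      (by rw [hin]; linarith)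
    rw [hin, Submodule.reflection_reflection, neg_sq] at this
    linarith

/-- The one-point estimator `(d / δ) c (b + δ s) s` is, up to `2 L δ`, a subgradient of `c` at `b`
in expectation. -/
lemma ConvexOn.sub_le_integral_uniformSphere {d : ℕ} {c : Vec d → ℝ}
    (hc : ConvexOn ℝ Set.univ c) {K : Set (Vec d)} {L : ℝ≥0} (hL : LipschitzOnWith L c K)
    {δ : ℝ} (hδ : 0 < δ) {b w : Vec d} (hb : b ∈ K) (hw : w ∈ K)
    (hbs : ∀ s : Vec d, ‖s‖ = 1 → b + δ • s ∈ K) (hws : ∀ s : Vec d, ‖s‖ = 1 → w + δ • s ∈ K) :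
    c b - c w - 2 * L * δ ≤
      ∫ s, d / δ * c (b + δ • (s : Vec d)) * inner ℝ (s : Vec d) (b - w) ∂uniformSphere d := by
  by_cases hv : b - w = 0
  · have : b = w := sub_eq_zero.1 hv
    simp only [hv, inner_zero_right, mul_zero, integral_zero]
    rw [this]
    have : 0 ≤ 2 * L * δ := by positivity
    linarith
  have hd : d ≠ 0 := by
    rintro rfl
    exact hv (Subsingleton.elim _ _)
  have hd' : (d : ℝ) ≠ 0 := by exact_mod_cast hd
  have hcc : Continuous c := hc.locallyLipschitz.continuous
  set v := b - w with hvdef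
  set U := (ℝ ∙ v)ᗮ.reflection with hU
  have hclose : ∀ x ∈ K, ∀ s : Vec d, ‖s‖ = 1 → x + δ • s ∈ K →
      |c (x + δ • s) - c x| ≤ L * δ := by
    intro x hx s hs hxs
    have := hL.dist_le_mul _ hxs _ hx
    simpa [Real.dist_eq, dist_eq_norm, norm_smul, hs, abs_of_pos hδ] using this
  have hD : ∀ s : Vec d, ‖s‖ = 1 →
      c b - c w - 2 * L * δ ≤ c (b + δ • s) - c (b - v + δ • s) := by
    intro s hs
    have h1 := abs_le.1 (hclose b hb s hs (hbs s hs))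
    have h2 := abs_le.1 (hclose w hw s hs (hws s hs))
    rw [hvdef, sub_sub_cancel]
    linarith
  have hFc : Continuous fun s : Metric.sphere (0 : Vec d) 1 =>
      inner ℝ (s : Vec d) v * c (b + δ • (s : Vec d)) := by fun_prop
  have hpair : ∀ s : Metric.sphere (0 : Vec d) 1,
      2 * δ * (c b - c w - 2 * L * δ) / ‖v‖ ^ 2 * inner ℝ (s : Vec d) v ^ 2 ≤
        inner ℝ (s : Vec d) v * c (b + δ • (s : Vec d)) +
        inner ℝ (sphereMap U s : Vec d) v * c (b + δ • (sphereMap U s : Vec d)) := by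
    intro s
    have h1 := hc.sq_inner_mul_le_reflection hδ hv hD (s := s) (by simp)
    have hin : inner ℝ (sphereMap U s : Vec d) v = -inner ℝ (s : Vec d) v := by
      have : U v = -v := Submodule.reflection_orthogonalComplement_singleton_eq_neg v
      have h2 := U.inner_map_map (s : Vec d) v
      rw [this, inner_neg_right] at h2
      simp only [sphereMap]
      linarith
    rw [hin]
    simp only [sphereMap]
    linarith
  have hFU : Continuous fun s : Metric.sphere (0 : Vec d) 1 =>
      inner ℝ (sphereMap U s : Vec d) v * c (b + δ • (sphereMap U s : Vec d)) := by
    simp only [sphereMap]; fun_prop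
  have hint := integral_mono (μ := uniformSphere d)
    (integrable_uniformSphere (by fun_prop))
    ((integrable_uniformSphere hFc).add (integrable_uniformSphere hFU)) hpair
  rw [integral_const_mul, integral_inner_sq_uniformSphere hd] at hint
  have hadd := integral_add (integrable_uniformSphere hFc) (integrable_uniformSphere hFU)
  simp only [Pi.add_apply] at hint
  rw [hadd, integral_comp_sphereMap U hFc] at hint
  have e : ∀ s : Metric.sphere (0 : Vec d) 1,
      d / δ * c (b + δ • (s : Vec d)) * inner ℝ (s : Vec d) v =
      d / δ * (inner ℝ (s : Vec d) v * c (b + δ • (s : Vec d))) := fun s => by ring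
  simp only [e]
  rw [integral_const_mul]
  have hv2 : ‖v‖ ^ 2 ≠ 0 := by simpa using hv
  calc c b - c w - 2 * L * δ
      = d / (2 * δ) * (2 * δ * (c b - c w - 2 * L * δ) / ‖v‖ ^ 2 * (‖v‖ ^ 2 / d)) := by
        field_simp
    _ ≤ d / (2 * δ) * _ := mul_le_mul_of_nonneg_left hint (by positivity)
    _ = _ := by field_simp; ring

/-! ### Euclidean projection and the shrunken feasible set -/

lemma IsEuclideanProj.inner_le_zero {d : ℕ} {C : Set (Vec d)} (hC : Convex ℝ C) {v p : Vec d}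
    (hp : IsEuclideanProj C v p) {w : Vec d} (hw : w ∈ C) : inner ℝ (v - p) (w - p) ≤ 0 := by
  have : Nonempty C := ⟨⟨p, hp.1⟩⟩
  refine (norm_eq_iInf_iff_real_inner_le_zero hC hp.1).1 (le_antisymm ?_ ?_) w hw
  · exact le_ciInf fun q => hp.2 q q.2
  · exact ciInf_le ⟨0, Set.forall_mem_range.2 fun _ => norm_nonneg _⟩ (⟨p, hp.1⟩ : C)

lemma IsEuclideanProj.norm_sub_le {d : ℕ} {C : Set (Vec d)} (hC : Convex ℝ C) {v w p q : Vec d}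
    (hp : IsEuclideanProj C v p) (hq : IsEuclideanProj C w q) : ‖p - q‖ ≤ ‖v - w‖ := by
  have h1 := hp.inner_le_zero hC hq.1
  have h2 := hq.inner_le_zero hC hp.1
  have h3 : ‖p - q‖ ^ 2 ≤ inner ℝ (v - w) (p - q) := by
    rw [← real_inner_self_eq_norm_sq]
    have e : inner ℝ (p - q) (p - q) =
        inner ℝ (v - w) (p - q) + inner ℝ (v - p) (q - p) + inner ℝ (w - q) (p - q) := by
      simp only [inner_sub_left, inner_sub_right]
      ring
    linarith
  have h4 := h3.trans (real_inner_le_norm _ _)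
  by_contra! hlt
  nlinarith [norm_nonneg (v - w)]

lemma IsEuclideanProj.norm_sub_mem_le {d : ℕ} {C : Set (Vec d)} (hC : Convex ℝ C) {v p w : Vec d}
    (hp : IsEuclideanProj C v p) (hw : w ∈ C) : ‖p - w‖ ≤ ‖v - w‖ :=
  hp.norm_sub_le hC ⟨hw, by simp⟩

lemma exists_isEuclideanProj {d : ℕ} {C : Set (Vec d)} (hC : IsCompact C) (hne : C.Nonempty)
    (v : Vec d) : ∃ p, IsEuclideanProj C v p := by
  obtain ⟨p, hp, hmin⟩ := hC.exists_isMinOn hne (f := fun p => ‖v - p‖) (by fun_prop)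
  exact ⟨p, hp, fun q hq => hmin hq⟩

lemma measurable_isEuclideanProj {d : ℕ} {C : Set (Vec d)} (hC : Convex ℝ C) (hC' : IsCompact C)
    (hne : C.Nonempty) {Ω : Type*} {m : MeasurableSpace Ω} {X Y : Ω → Vec d} (hX : Measurable X)
    (hXY : ∀ ω, IsEuclideanProj C (X ω) (Y ω)) : Measurable Y := by
  choose proj hproj using exists_isEuclideanProj hC' hne
  have hlip : LipschitzWith 1 proj := LipschitzWith.of_dist_le_mul fun v w => by
    simpa [dist_eq_norm] using (hproj v).norm_sub_le hC (hproj w)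
  have : Y = proj ∘ X := by
    ext1 ω
    have := (hXY ω).norm_sub_le hC (hproj (X ω))
    rw [sub_self, norm_zero] at this
    exact sub_eq_zero.1 (norm_le_zero_iff.1 this)
  rw [this]
  exact hlip.continuous.measurable.comp hX

lemma convex_shrink {d : ℕ} {K : Set (Vec d)} (hK : Convex ℝ K) (δ : ℝ) :
    Convex ℝ (shrink K δ) :=
  hK.smul (1 - δ)

lemma isCompact_shrink {d : ℕ} {K : Set (Vec d)} (hK : IsCompact K) (δ : ℝ) :
    IsCompact (shrink K δ) :=
  hK.image (by fun_prop)

lemma add_smul_mem_of_mem_shrink {d : ℕ} {K : Set (Vec d)} (hK : Convex ℝ K)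
    (hball : Metric.closedBall (0 : Vec d) 1 ⊆ K) {δ : ℝ} (hδ0 : 0 < δ) (hδ1 : δ ≤ 1) {b : Vec d}
    (hb : b ∈ shrink K δ) {s : Vec d} (hs : ‖s‖ ≤ 1) : b + δ • s ∈ K := by
  obtain ⟨k, hk, rfl⟩ := hb
  exact hK hk (hball (by simpa using hs)) (by linarith) hδ0.le (by ring)

lemma shrink_subset {d : ℕ} {K : Set (Vec d)} (hK : Convex ℝ K)
    (hball : Metric.closedBall (0 : Vec d) 1 ⊆ K) {δ : ℝ} (hδ0 : 0 < δ) (hδ1 : δ ≤ 1) :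
    shrink K δ ⊆ K := fun b hb => by
  simpa using add_smul_mem_of_mem_shrink hK hball hδ0 hδ1 hb (s := 0) (by simp)

lemma norm_le_of_mem_subdifferential {d : ℕ} {K : Set (Vec d)} {c : Vec d → ℝ} {L : ℝ≥0}
    (hL : LipschitzOnWith L c K) {δ : ℝ} (hδ : 0 < δ) {b g : Vec d} (hb : b ∈ K)
    (hbs : ∀ s : Vec d, ‖s‖ ≤ 1 → b + δ • s ∈ K) (hg : g ∈ subdifferential c b) : ‖g‖ ≤ L := by
  by_cases h0 : g = 0
  · simp [h0]
  have hn : 0 < ‖g‖ := norm_pos_iff.2 h0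
  -- Test the subgradient inequality at `b + δ g / ‖g‖`.
  have hs : ‖‖g‖⁻¹ • g‖ = 1 := by rw [norm_smul, norm_inv, norm_norm, inv_mul_cancel₀ hn.ne']
  have h1 := hg (b + δ • ‖g‖⁻¹ • g)
  have h2 := (le_abs_self _).trans (hL.dist_le_mul _ (hbs _ hs.le) _ hb)
  rw [dist_eq_norm, add_sub_cancel_left, norm_smul, hs, Real.norm_of_nonneg hδ.le] at h2
  have h3 : inner ℝ g (b + δ • ‖g‖⁻¹ • g - b) = δ * ‖g‖ := by
    rw [add_sub_cancel_left, real_inner_smul_right, real_inner_smul_right,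
      real_inner_self_eq_norm_sq]
    field_simp
  rw [h3] at h1
  nlinarith

/-! ### Projected gradient descent -/

/-- One step of projected gradient descent. -/
lemma inner_le_of_isEuclideanProj {d : ℕ} {C : Set (Vec d)} (hC : Convex ℝ C) {η : ℝ} (hη : 0 < η)
    {b g p w : Vec d} (hp : IsEuclideanProj C (b - η • g) p) (hw : w ∈ C) :
    inner ℝ g (b - w) ≤ 1 / (2 * η) * (‖b - w‖ ^ 2 - ‖p - w‖ ^ 2) + η / 2 * ‖g‖ ^ 2 := by
  have h1 := pow_le_pow_left₀ (norm_nonneg _) (hp.norm_sub_mem_le hC hw) 2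
  have e : b - η • g - w = b - w - η • g := by abel
  rw [e, norm_sub_sq_real (b - w), real_inner_smul_right, norm_smul, mul_pow, Real.norm_eq_abs,
    sq_abs, real_inner_comm] at h1
  have h2 : 2 * η * inner ℝ g (b - w) ≤
      ‖b - w‖ ^ 2 - ‖p - w‖ ^ 2 + η ^ 2 * ‖g‖ ^ 2 := by linarith
  calc inner ℝ g (b - w) = 1 / (2 * η) * (2 * η * inner ℝ g (b - w)) := by field_simp
    _ ≤ 1 / (2 * η) * (‖b - w‖ ^ 2 - ‖p - w‖ ^ 2 + η ^ 2 * ‖g‖ ^ 2) :=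
      mul_le_mul_of_nonneg_left h2 (by positivity)
    _ = _ := by field_simp

lemma Fin.sum_castSucc_sub_succ {n : ℕ} (D : Fin (n + 1) → ℝ) :
    ∑ t : Fin n, (D t.castSucc - D t.succ) = D 0 - D (Fin.last n) := by
  have h1 := Fin.sum_univ_castSucc D
  have h2 := Fin.sum_univ_succ D
  rw [Finset.sum_sub_distrib]
  linarith

lemma sum_inner_le_of_isEuclideanProj {d n : ℕ} {C : Set (Vec d)} (hC : Convex ℝ C) {η : ℝ}
    (hη : 0 < η) {b : Fin (n + 1) → Vec d} {g : Fin n → Vec d}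
    (hb : ∀ t : Fin n, IsEuclideanProj C (b t.castSucc - η • g t) (b t.succ)) {w : Vec d}
    (hw : w ∈ C) :
    ∑ t, inner ℝ (g t) (b t.castSucc - w) ≤
      1 / (2 * η) * ‖b 0 - w‖ ^ 2 + η / 2 * ∑ t, ‖g t‖ ^ 2 := by
  have h1 := Finset.sum_le_sum fun t (_ : t ∈ Finset.univ) =>
    inner_le_of_isEuclideanProj hC hη (hb t) hw
  rw [Finset.sum_add_distrib, ← Finset.mul_sum, ← Finset.mul_sum,
    Fin.sum_castSucc_sub_succ fun t => ‖b t - w‖ ^ 2] at h1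
  refine h1.trans (by gcongr; simp)

/-! ### Runs of the algorithm -/

/-- A bound on the squared length of the step direction against the agent `a`. -/
noncomputable def gradientSqBound {d : ℕ} (a : Agent d) (δ M L : ℝ) : ℝ :=
  if a.y = -1 then (d : ℝ) ^ 2 * M ^ 2 / δ ^ 2 else L ^ 2

lemma sum_gradientSqBound {d n : ℕ} (A : Fin n → Agent d) (δ M L : ℝ) :
    ∑ t, gradientSqBound (A t) δ M L =
      n * strategicFraction A * ((d : ℝ) ^ 2 * M ^ 2 / δ ^ 2) +
        n * (1 - strategicFraction A) * L ^ 2 := by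
  have hθ : n * strategicFraction A =
      ((Finset.univ.filter fun t => (A t).y = -1).card : ℝ) := by
    rcases Nat.eq_zero_or_pos n with rfl | hn
    · simp
    · have : (n : ℝ) ≠ 0 := by positivity
      rw [strategicFraction]
      field_simp
  have hc : ((Finset.univ.filter fun t => ¬ (A t).y = -1).card : ℝ) =
      n - ((Finset.univ.filter fun t => (A t).y = -1).card : ℝ) := by
    have := Finset.card_filter_add_card_filter_not (s := Finset.univ) fun t => (A t).y = -1
    rw [Finset.card_univ, Fintype.card_fin] at this
    have := congrArg (Nat.cast : ℕ → ℝ) this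
    push_cast at this
    linarith
  simp only [gradientSqBound]
  rw [Finset.sum_ite, Finset.sum_const, Finset.sum_const, nsmul_eq_mul, nsmul_eq_mul, hc,
    mul_sub, hθ, mul_one]

lemma integrable_comp_of_abs_le {d : ℕ} {K : Set (Vec d)} {Ω : Type*}
    {mΩ : MeasurableSpace Ω} {P : Measure Ω} [IsFiniteMeasure P] {c : Vec d → ℝ}
    (hc : Continuous c) {M : ℝ}
    (hM : ∀ β ∈ K, |c β| ≤ M) {B : Ω → Vec d} (hB : Measurable B) (hBK : ∀ ω, B ω ∈ K) :
    Integrable (fun ω => c (B ω)) P :=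
  Integrable.of_bound (hc.measurable.comp hB).aestronglyMeasurable M
    (Filter.Eventually.of_forall fun ω => hM _ (hBK ω))

namespace IsMixtureRun

variable {d n : ℕ} {K : Set (Vec d)} {h : ℝ → ℝ} {A : Fin n → Agent d}
  {xhat : Fin n → Vec d → Vec d} {δ η : ℝ} {b₁ : Vec d} {Ω : Type*} [mΩ : MeasurableSpace Ω]
  {P : Measure Ω} {ℱ : Filtration (Fin (n + 1)) mΩ} {S : Fin n → Ω → Metric.sphere (0 : Vec d) 1}
  {g : Fin n → Ω → Vec d} {β : Fin (n + 1) → Ω → Vec d}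

lemma mem_shrink (hrun : IsMixtureRun K h A xhat δ η b₁ P ℱ S g β) (hb₁ : b₁ ∈ shrink K δ)
    (t : Fin (n + 1)) (ω : Ω) : β t ω ∈ shrink K δ := by
  cases t using Fin.cases with
  | zero => rw [hrun.init]; exact hb₁
  | succ t => exact (hrun.update t ω).1

lemma measurable_iterate (hrun : IsMixtureRun K h A xhat δ η b₁ P ℱ S g β) (hK : Convex ℝ K)
    (hK' : IsCompact K) (hb₁ : b₁ ∈ shrink K δ) (t : Fin (n + 1)) : Measurable[ℱ t] (β t) := by
  induction t using Fin.induction with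
  | zero =>
    rw [funext hrun.init]
    exact @measurable_const _ _ _ (ℱ 0) _
  | succ t ih =>
    have h1 : Measurable[ℱ t.succ] (β t.castSucc) :=
      ih.mono (ℱ.mono (Fin.castSucc_le_succ t)) le_rfl
    exact measurable_isEuclideanProj (convex_shrink hK δ) (isCompact_shrink hK' δ) ⟨b₁, hb₁⟩
      (h1.sub ((hrun.measurable_gradient t).const_smul η)) (hrun.update t)

lemma measurable_direction_ambient (hrun : IsMixtureRun K h A xhat δ η b₁ P ℱ S g β) (t : Fin n) :
    Measurable (S t) :=
  (hrun.measurable_direction t).mono (ℱ.le _) le_rfl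

lemma norm_gradient_sq_le (hrun : IsMixtureRun K h A xhat δ η b₁ P ℱ S g β) (hK : Convex ℝ K)
    (hball : Metric.closedBall (0 : Vec d) 1 ⊆ K) (hδ0 : 0 < δ) (hδ1 : δ ≤ 1)
    (hb₁ : b₁ ∈ shrink K δ) {M : ℝ} (hM : ∀ t, ∀ β ∈ K, |roundLoss h (A t) (xhat t) β| ≤ M)
    {L : ℝ≥0} (hL : ∀ t, LipschitzOnWith L (roundLoss h (A t) (xhat t)) K) (t : Fin n) (ω : Ω) :
    ‖g t ω‖ ^ 2 ≤ gradientSqBound (A t) δ M L := by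
  have hmem := hrun.mem_shrink hb₁ t.castSucc ω
  have hmove : ∀ s : Vec d, ‖s‖ ≤ 1 → β t.castSucc ω + δ • s ∈ K := fun s hs =>
    add_smul_mem_of_mem_shrink hK hball hδ0 hδ1 hmem hs
  rcases (A t).y_mem with hy | hy
  · rw [gradientSqBound, if_neg (by rw [hy]; decide)]
    exact pow_le_pow_left₀ (norm_nonneg _) (norm_le_of_mem_subdifferential (hL t) hδ0
      (shrink_subset hK hball hδ0 hδ1 hmem) hmove (hrun.gradient_nonstrategic t hy ω)) 2
  · rw [gradientSqBound, if_pos hy, hrun.gradient_strategic t hy ω, norm_smul, norm_eq_of_mem_sphere,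
      mul_one, Real.norm_eq_abs, sq_abs, mul_pow, div_pow, mul_div_right_comm]
    refine mul_le_mul_of_nonneg_left ?_ (by positivity)
    rw [← sq_abs]
    exact pow_le_pow_left₀ (abs_nonneg _) (hM t _ (hmove _ (by simp))) 2

/-- Against a strategic agent, the expected regret of the iterate is controlled by the expected
linearized regret: since `S t` is independent of `β t`, their joint law is a product, and the
deterministic one-point estimate applies at almost every value of `β t`. -/
lemma integral_sub_le_of_strategic [IsProbabilityMeasure P]
    (hrun : IsMixtureRun K h A xhat δ η b₁ P ℱ S g β) (hK : Convex ℝ K) (hK' : IsCompact K)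
    (hball : Metric.closedBall (0 : Vec d) 1 ⊆ K) (hδ0 : 0 < δ) (hδ1 : δ ≤ 1)
    (hb₁ : b₁ ∈ shrink K δ) {t : Fin n}
    (hconv : ConvexOn ℝ Set.univ (roundLoss h (A t) (xhat t)))
    {L : ℝ≥0} (hL : LipschitzOnWith L (roundLoss h (A t) (xhat t)) K) (hy : (A t).y = -1)
    {w : Vec d} (hw : w ∈ shrink K δ)
    (hint : Integrable (fun ω => inner ℝ (g t ω) (β t.castSucc ω - w)) P)
    (hintc : Integrable (fun ω => roundLoss h (A t) (xhat t) (β t.castSucc ω)) P) :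
    ∫ ω, roundLoss h (A t) (xhat t) (β t.castSucc ω) ∂P - roundLoss h (A t) (xhat t) w -
      2 * L * δ ≤ ∫ ω, inner ℝ (g t ω) (β t.castSucc ω - w) ∂P := by
  set c := roundLoss h (A t) (xhat t)
  have hcc : Continuous c := hconv.locallyLipschitz.continuous
  have hβ' := hrun.measurable_iterate hK hK' hb₁ t.castSucc
  have hβ : Measurable (β t.castSucc) := hβ'.mono (ℱ.le _) le_rfl
  have hS := hrun.measurable_direction_ambient t
  have hindep : IndepFun (β t.castSucc) (S t) P :=
    (IndepFun_iff_Indep _ _ _).2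
      (indep_of_indep_of_le_left (hrun.direction_fresh t).symm hβ'.comap_le)
  have hlaw : P.map (fun ω => (β t.castSucc ω, S t ω)) =
      (P.map (β t.castSucc)).prod (uniformSphere d) := by
    rw [(indepFun_iff_map_prod_eq_prod_map_map hβ.aemeasurable hS.aemeasurable).1 hindep,
      hrun.direction_law]
  set ψ : Vec d × Metric.sphere (0 : Vec d) 1 → ℝ := fun p =>
    d / δ * c (p.1 + δ • (p.2 : Vec d)) * inner ℝ (p.2 : Vec d) (p.1 - w)
  have hψ : Continuous ψ := by fun_prop
  have hgψ : ∀ ω, inner ℝ (g t ω) (β t.castSucc ω - w) = ψ (β t.castSucc ω, S t ω) := by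
    intro ω
    rw [hrun.gradient_strategic t hy ω, real_inner_smul_left]
    rfl
  simp only [hgψ] at hint ⊢
  have hpair : Measurable fun ω => (β t.castSucc ω, S t ω) := hβ.prodMk hS
  have hintψ : Integrable ψ ((P.map (β t.castSucc)).prod (uniformSphere d)) := by
    rw [← hlaw, integrable_map_measure hψ.aestronglyMeasurable hpair.aemeasurable]
    exact hint
  have hintΦ := hintψ.integral_prod_left
  have e : ∫ ω, ψ (β t.castSucc ω, S t ω) ∂P =
      ∫ ω, (∫ s, ψ (β t.castSucc ω, s) ∂uniformSphere d) ∂P := by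
    rw [← integral_map (f := ψ) hpair.aemeasurable hψ.aestronglyMeasurable, hlaw,
      integral_prod _ hintψ, integral_map hβ.aemeasurable hintΦ.aestronglyMeasurable]
  rw [e]
  have hmono : ∫ ω, (c (β t.castSucc ω) - (c w + 2 * L * δ)) ∂P ≤
      ∫ ω, (∫ s, ψ (β t.castSucc ω, s) ∂uniformSphere d) ∂P := by
    refine integral_mono (hintc.sub (integrable_const _))
      ((integrable_map_measure hintΦ.aestronglyMeasurable hβ.aemeasurable).1 hintΦ) fun ω => ?_
    have hmem := hrun.mem_shrink hb₁ t.castSucc ω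
    simp only [← sub_sub]
    exact hconv.sub_le_integral_uniformSphere hL hδ0 (shrink_subset hK hball hδ0 hδ1 hmem)
      (shrink_subset hK hball hδ0 hδ1 hw)
      (fun s hs => add_smul_mem_of_mem_shrink hK hball hδ0 hδ1 hmem hs.le)
      (fun s hs => add_smul_mem_of_mem_shrink hK hball hδ0 hδ1 hw hs.le)
  refine le_trans (le_of_eq ?_) hmono
  rw [integral_sub hintc (integrable_const _)]
  simp [sub_sub]

/-- The expected regret of the iterates against a fixed comparator in the shrunken set. -/
lemma sum_integral_sub_le [IsProbabilityMeasure P]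
    (hrun : IsMixtureRun K h A xhat δ η b₁ P ℱ S g β) (hK : Convex ℝ K) (hK' : IsCompact K)
    (hball : Metric.closedBall (0 : Vec d) 1 ⊆ K) (hδ0 : 0 < δ) (hδ1 : δ ≤ 1) (hη : 0 < η)
    (hb₁ : b₁ ∈ shrink K δ)
    (hconv : ∀ t, ConvexOn ℝ Set.univ (roundLoss h (A t) (xhat t)))
    {M : ℝ} (hM : ∀ t, ∀ β ∈ K, |roundLoss h (A t) (xhat t) β| ≤ M)
    {L : ℝ≥0} (hL : ∀ t, LipschitzOnWith L (roundLoss h (A t) (xhat t)) K)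
    {R : ℝ} (hRb₁ : ∀ β ∈ shrink K δ, ‖β - b₁‖ ≤ R) {w : Vec d} (hw : w ∈ shrink K δ) :
    ∑ t, (∫ ω, roundLoss h (A t) (xhat t) (β t.castSucc ω) ∂P - roundLoss h (A t) (xhat t) w) ≤
      1 / (2 * η) * R ^ 2 + η / 2 * ∑ t, gradientSqBound (A t) δ M L + 2 * n * L * δ := by
  have hβ : ∀ t, Measurable (β t) := fun t =>
    (hrun.measurable_iterate hK hK' hb₁ t).mono (ℱ.le _) le_rfl
  have hg : ∀ t, Measurable (g t) := fun t => (hrun.measurable_gradient t).mono (ℱ.le _) le_rfl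
  have hβK : ∀ t ω, β t ω ∈ K := fun t ω =>
    shrink_subset hK hball hδ0 hδ1 (hrun.mem_shrink hb₁ t ω)
  have hG := hrun.norm_gradient_sq_le hK hball hδ0 hδ1 hb₁ hM hL
  have hdist : ∀ b ∈ shrink K δ, ‖b - w‖ ≤ 2 * R := fun b hb => by
    have h1 := norm_sub_le (b - b₁) (w - b₁)
    rw [sub_sub_sub_cancel_right] at h1
    linarith [hRb₁ b hb, hRb₁ w hw]
  have hintc : ∀ t : Fin n,
      Integrable (fun ω => roundLoss h (A t) (xhat t) (β t.castSucc ω)) P := fun t =>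
    integrable_comp_of_abs_le (hconv t).locallyLipschitz.continuous (hM t) (hβ _) (hβK _)
  have hint : ∀ t, Integrable (fun ω => inner ℝ (g t ω) (β t.castSucc ω - w)) P := by
    intro t
    refine Integrable.of_bound ((hg t).inner ((hβ _).sub_const w)).aestronglyMeasurable
      (√(gradientSqBound (A t) δ M L) * (2 * R)) (Filter.Eventually.of_forall fun ω => ?_)
    refine (norm_inner_le_norm _ _).trans ?_
    exact mul_le_mul (Real.le_sqrt_of_sq_le (hG t ω)) (hdist _ (hrun.mem_shrink hb₁ _ ω))
      (norm_nonneg _) (Real.sqrt_nonneg _)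
  have hround : ∀ t, ∫ ω, roundLoss h (A t) (xhat t) (β t.castSucc ω) ∂P -
      roundLoss h (A t) (xhat t) w ≤
        ∫ ω, inner ℝ (g t ω) (β t.castSucc ω - w) ∂P + 2 * L * δ := by
    intro t
    rcases (A t).y_mem with hy | hy
    · have h1 := integral_mono ((hintc t).sub (integrable_const _)) (hint t) fun ω => by
        have := hrun.gradient_nonstrategic t hy ω w
        rw [← neg_sub (β t.castSucc ω) w, inner_neg_right] at this
        show roundLoss h (A t) (xhat t) (β t.castSucc ω) - roundLoss h (A t) (xhat t) w ≤ _
        linarith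
      simp only [Pi.sub_apply] at h1
      rw [integral_sub (hintc t) (integrable_const _)] at h1
      simp only [integral_const, probReal_univ, one_smul] at h1
      have : 0 ≤ 2 * L * δ := by positivity
      linarith
    · have := hrun.integral_sub_le_of_strategic hK hK' hball hδ0 hδ1 hb₁ (hconv t) (hL t) hy hw
        (hint t) (hintc t)
      linarith
  have hpath : ∀ ω, ∑ t, inner ℝ (g t ω) (β t.castSucc ω - w) ≤
      1 / (2 * η) * R ^ 2 + η / 2 * ∑ t, gradientSqBound (A t) δ M L := by
    intro ω
    refine (sum_inner_le_of_isEuclideanProj (convex_shrink hK δ) hη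
      (b := fun t => β t ω) (g := fun t => g t ω) (fun t => hrun.update t ω) hw).trans ?_
    have : ‖β 0 ω - w‖ ≤ R := by rw [hrun.init, norm_sub_rev]; exact hRb₁ w hw
    gcongr with t
    exact hG t ω
  have hexp := integral_mono (integrable_finsetSum _ fun t _ => hint t)
    (integrable_const (μ := P) _) hpath
  rw [integral_finsetSum _ fun t _ => hint t] at hexp
  simp only [integral_const, probReal_univ, one_smul] at hexp
  calc _ ≤ ∑ t, (∫ ω, inner ℝ (g t ω) (β t.castSucc ω - w) ∂P + 2 * L * δ) :=
        Finset.sum_le_sum fun t _ => hround t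
    _ = ∑ t, ∫ ω, inner ℝ (g t ω) (β t.castSucc ω - w) ∂P + 2 * n * L * δ := by
        rw [Finset.sum_add_distrib]
        simp
        ring
    _ ≤ _ := by gcongr

/-- The regret bound for any classifiers whose losses exceed those of the iterates by at most
`L δ`, which covers both the deployed classifiers and the iterates themselves. -/
theorem integral_stackelbergRegret_le [IsProbabilityMeasure P]
    (hrun : IsMixtureRun K h A xhat δ η b₁ P ℱ S g β) (hK : Convex ℝ K) (hK' : IsCompact K)
    (hball : Metric.closedBall (0 : Vec d) 1 ⊆ K) (hδ0 : 0 < δ) (hδ1 : δ ≤ 1) (hη : 0 < η)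
    (hb₁ : b₁ ∈ shrink K δ)
    (hconv : ∀ t, ConvexOn ℝ Set.univ (roundLoss h (A t) (xhat t)))
    {M : ℝ} (hM : ∀ t, ∀ β ∈ K, |roundLoss h (A t) (xhat t) β| ≤ M)
    {L : ℝ≥0} (hL : ∀ t, LipschitzOnWith L (roundLoss h (A t) (xhat t)) K)
    {R : ℝ} (hR : ∀ β ∈ K, ‖β‖ ≤ R) (hRb₁ : ∀ β ∈ shrink K δ, ‖β - b₁‖ ≤ R)
    {B : Fin n → Ω → Vec d} (hB : ∀ t, Measurable (B t)) (hBK : ∀ t ω, B t ω ∈ K)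
    (hBβ : ∀ t ω, roundLoss h (A t) (xhat t) (B t ω) ≤
      roundLoss h (A t) (xhat t) (β t.castSucc ω) + L * δ) :
    Integrable (fun ω => stackelbergRegret K h A xhat (fun t => B t ω)) P ∧
      ∫ ω, stackelbergRegret K h A xhat (fun t => B t ω) ∂P ≤
        regretBound n d (strategicFraction A) η δ M L R := by
  have hβK : ∀ t ω, β t ω ∈ K := fun t ω =>
    shrink_subset hK hball hδ0 hδ1 (hrun.mem_shrink hb₁ t ω)
  have hint : ∀ {B : Fin n → Ω → Vec d}, (∀ t, Measurable (B t)) → (∀ t ω, B t ω ∈ K) → ∀ t,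
      Integrable (fun ω => roundLoss h (A t) (xhat t) (B t ω)) P := fun hB hBK t =>
    integrable_comp_of_abs_le (hconv t).locallyLipschitz.continuous (hM t) (hB t) (hBK t)
  have hintB := hint hB hBK
  have hintβ := hint (B := fun t => β t.castSucc)
    (fun t => (hrun.measurable_iterate hK hK' hb₁ _).mono (ℱ.le _) le_rfl) (fun t => hβK _)
  have hsum := integrable_finsetSum Finset.univ fun t _ => hintB t
  refine ⟨hsum.sub (integrable_const _), ?_⟩
  simp only [stackelbergRegret]
  rw [integral_sub hsum (integrable_const _), integral_finsetSum _ fun t _ => hintB t,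
    integral_const, probReal_univ, one_smul, sub_le_comm]
  have hne : K.Nonempty := ⟨0, hball (by simp)⟩
  -- No minimizer is needed: the bound holds against every comparator `u ∈ K`.
  refine le_csInf (hne.image _) ?_
  rintro _ ⟨u, hu, rfl⟩
  have hw : (1 - δ) • u ∈ shrink K δ := ⟨u, hu, rfl⟩
  have h1 := hrun.sum_integral_sub_le hK hK' hball hδ0 hδ1 hη hb₁ hconv hM hL hRb₁ hw
  have h2 : ∀ t, roundLoss h (A t) (xhat t) ((1 - δ) • u) ≤
      roundLoss h (A t) (xhat t) u + L * R * δ := by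
    intro t
    have h3 := (le_abs_self _).trans
      ((hL t).dist_le_mul _ (shrink_subset hK hball hδ0 hδ1 hw) _ hu)
    have h4 : dist ((1 - δ) • u) u ≤ R * δ := by
      have e : (1 - δ) • u - u = (-δ) • u := by module
      rw [dist_eq_norm, e, norm_smul, norm_neg, Real.norm_of_nonneg hδ0.le, mul_comm]
      gcongr
      exact hR u hu
    have h5 := mul_le_mul_of_nonneg_left h4 L.coe_nonneg
    linarith
  have h6 : ∀ t, ∫ ω, roundLoss h (A t) (xhat t) (B t ω) ∂P ≤
      ∫ ω, roundLoss h (A t) (xhat t) (β t.castSucc ω) ∂P + L * δ := by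
    intro t
    have := integral_mono (hintB t) ((hintβ t).add (integrable_const _)) (hBβ t)
    simp only [Pi.add_apply] at this
    rw [integral_add (hintβ t) (integrable_const _)] at this
    simpa using this
  have h7 := Finset.sum_le_sum fun t (_ : t ∈ Finset.univ) => h2 t
  have h8 := Finset.sum_le_sum fun t (_ : t ∈ Finset.univ) => h6 t
  rw [Finset.sum_add_distrib, Finset.sum_const, nsmul_eq_mul, Finset.card_univ,
    Fintype.card_fin] at h7 h8
  rw [Finset.sum_sub_distrib, sum_gradientSqBound] at h1
  rw [regretBound]
  linarith

end IsMixtureRun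

theorem theorem3 {d n : ℕ} (K : Set (Vec d)) (hKclosed : IsClosed K) (hKconvex : Convex ℝ K)
    (hKball : Metric.closedBall (0 : Vec d) 1 ⊆ K)
    -- margin loss, non-increasing and convex (e.g. logistic or hinge)
    (h : ℝ → ℝ) (hanti : Antitone h) (hconvex : ConvexOn ℝ Set.univ h)
    -- the agents, fixed in advance, and their responses, ties broken arbitrarily
    (A : Fin n → Agent d) (hA : ∀ t, (A t).y = -1 → AdmissibleCost (A t).cost)
    (xhat : Fin n → Vec d → Vec d) (hxhat : ∀ t β, xhat t β ∈ (A t).responses β)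
    -- bounded and Lipschitz round losses
    (M : ℝ) (hM : ∀ t, ∀ β ∈ K, |roundLoss h (A t) (xhat t) β| ≤ M)
    (L : ℝ≥0) (hL : ∀ t, LipschitzOnWith L (roundLoss h (A t) (xhat t)) K)
    -- parameters of the algorithm
    (δ η : ℝ) (hδ0 : 0 < δ) (hδ1 : δ ≤ 1) (hη : 0 < η)
    (b₁ : Vec d) (hb₁ : b₁ ∈ shrink K δ)
    (R : ℝ) (hR : ∀ β ∈ K, ‖β‖ ≤ R) (hRb₁ : ∀ β ∈ shrink K δ, ‖β - b₁‖ ≤ R)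
    -- a run of the algorithm
    {Ω : Type*} [mΩ : MeasurableSpace Ω] (P : Measure Ω) [IsProbabilityMeasure P]
    (ℱ : Filtration (Fin (n + 1)) mΩ) (S : Fin n → Ω → Metric.sphere (0 : Vec d) 1)
    (g : Fin n → Ω → Vec d) (β : Fin (n + 1) → Ω → Vec d)
    (hrun : IsMixtureRun K h A xhat δ η b₁ P ℱ S g β) :
    -- regret of the deployed classifiers `β_t + δ S_t`
    (Integrable (fun ω => stackelbergRegret K h A xhat
        (fun t => deployed δ (β t.castSucc ω) (S t ω))) P ∧
      ∫ ω, stackelbergRegret K h A xhat (fun t => deployed δ (β t.castSucc ω) (S t ω)) ∂P ≤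
        regretBound n d (strategicFraction A) η δ M L R) ∧
    -- regret of the iterates `β_t`
    (Integrable (fun ω => stackelbergRegret K h A xhat (fun t => β t.castSucc ω)) P ∧
      ∫ ω, stackelbergRegret K h A xhat (fun t => β t.castSucc ω) ∂P ≤
        regretBound n d (strategicFraction A) η δ M L R) := by
  have hK' : IsCompact K := Metric.isCompact_of_isClosed_isBounded hKclosed
    (isBounded_iff_forall_norm_le.2 ⟨R, hR⟩)
  have hconv : ∀ t, ConvexOn ℝ Set.univ (roundLoss h (A t) (xhat t)) := fun t =>
    convexOn_roundLoss hanti hconvex (hA t) (hxhat t)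
  have hβ : ∀ t, Measurable (β t) := fun t =>
    (hrun.measurable_iterate hKconvex hK' hb₁ t).mono (ℱ.le _) le_rfl
  have hβK : ∀ t ω, β t ω ∈ K := fun t ω =>
    shrink_subset hKconvex hKball hδ0 hδ1 (hrun.mem_shrink hb₁ t ω)
  have hdep : ∀ t ω, deployed δ (β t.castSucc ω) (S t ω) ∈ K := fun t ω =>
    add_smul_mem_of_mem_shrink hKconvex hKball hδ0 hδ1 (hrun.mem_shrink hb₁ _ ω) (by simp)
  constructor
  · refine hrun.integral_stackelbergRegret_le hKconvex hK' hKball hδ0 hδ1 hη hb₁ hconv hM hL hR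
      hRb₁ (B := fun t ω => deployed δ (β t.castSucc ω) (S t ω)) (fun t => ?_) hdep fun t ω => ?_
    · exact (hβ _).add
        ((measurable_subtype_coe.comp (hrun.measurable_direction_ambient t)).const_smul δ)
    · have := (le_abs_self _).trans ((hL t).dist_le_mul _ (hdep t ω) _ (hβK t.castSucc ω))
      rw [deployed, dist_eq_norm, add_sub_cancel_left, norm_smul, norm_eq_of_mem_sphere,
        Real.norm_of_nonneg hδ0.le, mul_one] at this
      rw [deployed]
      linarith
  · refine hrun.integral_stackelbergRegret_le hKconvex hK' hKball hδ0 hδ1 hη hb₁ hconv hM hL hR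
      hRb₁ (B := fun t => β t.castSucc) (fun t => hβ _) (fun t => hβK _) fun t ω => ?_
    have : 0 ≤ L * δ := by positivity
    linarith
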